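/- All algebras are associative, unital and over $\mathbb{Q}$. Let $n$ be a natural number. The double Orlik--Solomon algebra $OS_2(n)$ is the super-commutative algebra with odd generators $x_{ij}$, $y_{ij}$ ($1\le i\ne j\le n$; in particular any two generators anticommute) and relations, for all pairwise distinct $i,j,k\in\{1,\dots,n\}$ (only $i\neq j$ where $k$ does not occur), $$x_{ij}-x_{ji}=y_{ij}-y_{ji}=0,$$ $$x_{ij}x_{jk}+x_{jk}x_{ki}+x_{ki}x_{ij}=0,$$ $$x_{ij}y_{jk}+x_{jk}y_{ki}+x_{ki}y_{ij}+y_{ij}x_{jk}+y_{jk}x_{ki}+y_{ki}x_{ij}=0,$$ $$y_{ij}y_{jk}+y_{jk}y_{ki}+y_{ki}y_{ij}=0,$$ $$x_{ij}^2=x_{ij}y_{ij}=y_{ij}^2=0.$$ The double even Orlik--Solomon algebra $OS_2^+(n)$ is the super-commutative algebra with even generators $x_{ij}$, $y_{ij}$ ($1\le i\ne j\le n$; so the generators commute) and the same relations, except that the first line is replaced by $$x_{ij}+x_{ji}=y_{ij}+y_{ji}=0.$$ Then, for every $n$, $$\dim_{\mathbb{Q}} OS_2(n)=\dim_{\mathbb{Q}}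 OS_2^+(n)=(n+1)^{n-1}.$$ -/

import Mathlib

/-- The generators `x_{ij}` and `y_{ij}`, for `i ≠ j` in an index set of `n` elements
(the indices `1, …, n` are represented by `Fin n`). -/
inductive DoubleOSGen (n : ℕ) : Type
  | x (i j : Fin n) (h : i ≠ j) : DoubleOSGen n
  | y (i j : Fin n) (h : i ≠ j) : DoubleOSGen n

namespace DoubleOS

/-- The odd generator `x_{ij}` in the free associative algebra. -/
noncomputable def x {n : ℕ} (i j : Fin n) (h : i ≠ j) : FreeAlgebra ℚ (DoubleOSGen n) :=
  FreeAlgebra.ι ℚ (DoubleOSGen.x i j h)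

/-- The odd generator `y_{ij}` in the free associative algebra. -/
noncomputable def y {n : ℕ} (i j : Fin n) (h : i ≠ j) : FreeAlgebra ℚ (DoubleOSGen n) :=
  FreeAlgebra.ι ℚ (DoubleOSGen.y i j h)

/-- The defining relations of the double Orlik–Solomon algebra, in the free associative algebra.
The constructor `supercomm` says that any two generators, being odd, anticommute; so an algebra
generated by them is super-commutative. The other constructors are the relations listed in the
definition of the algebra. -/
inductive Rel (n : ℕ) :
    FreeAlgebra ℚ (DoubleOSGen n) → FreeAlgebra ℚ (DoubleOSGen n) → Prop
  | supercomm (a b : DoubleOSGen n) :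
      Rel n (FreeAlgebra.ι ℚ a * FreeAlgebra.ι ℚ b)
        (-(FreeAlgebra.ι ℚ b * FreeAlgebra.ι ℚ a))
  | x_symm (i j : Fin n) (h : i ≠ j) : Rel n (x i j h - x j i h.symm) 0
  | y_symm (i j : Fin n) (h : i ≠ j) : Rel n (y i j h - y j i h.symm) 0
  | xx (i j k : Fin n) (hij : i ≠ j) (hjk : j ≠ k) (hki : k ≠ i) :
      Rel n (x i j hij * x j k hjk + x j k hjk * x k i hki + x k i hki * x i j hij) 0
  | xy (i j k : Fin n) (hij : i ≠ j) (hjk : j ≠ k) (hki : k ≠ i) :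
      Rel n (x i j hij * y j k hjk + x j k hjk * y k i hki + x k i hki * y i j hij
        + y i j hij * x j k hjk + y j k hjk * x k i hki + y k i hki * x i j hij) 0
  | yy (i j k : Fin n) (hij : i ≠ j) (hjk : j ≠ k) (hki : k ≠ i) :
      Rel n (y i j hij * y j k hjk + y j k hjk * y k i hki + y k i hki * y i j hij) 0
  | x_sq (i j : Fin n) (h : i ≠ j) : Rel n (x i j h ^ 2) 0
  | x_mul_y (i j : Fin n) (h : i ≠ j) : Rel n (x i j h * y i j h) 0
  | y_sq (i j : Fin n) (h : i ≠ j) : Rel n (y i j h ^ 2) 0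

end DoubleOS

/-- The double Orlik–Solomon algebra over `ℚ`: the super-commutative associative unital algebra
with odd generators `x_{ij}`, `y_{ij}` and the relations above, as a quotient of the free
associative algebra. -/
abbrev DoubleOS (n : ℕ) : Type := RingQuot (DoubleOS.Rel n)

namespace DoubleEvenOS

/-- The even generator `x_{ij}` in the free commutative algebra. -/
noncomputable def x {n : ℕ} (i j : Fin n) (h : i ≠ j) : MvPolynomial (DoubleOSGen n) ℚ :=
  MvPolynomial.X (DoubleOSGen.x i j h)

/-- The even generator `y_{ij}` in the free commutative algebra. -/
noncomputable def y {n : ℕ} (i j : Fin n) (h : i ≠ j) : MvPolynomial (DoubleOSGen n) ℚ :=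
  MvPolynomial.X (DoubleOSGen.y i j h)

/-- The set of defining relators of the double even Orlik–Solomon algebra, in the polynomial
algebra: a super-commutative algebra with even generators is commutative. -/
inductive Relator (n : ℕ) : MvPolynomial (DoubleOSGen n) ℚ → Prop
  | x_skew (i j : Fin n) (h : i ≠ j) : Relator n (x i j h + x j i h.symm)
  | y_skew (i j : Fin n) (h : i ≠ j) : Relator n (y i j h + y j i h.symm)
  | xx (i j k : Fin n) (hij : i ≠ j) (hjk : j ≠ k) (hki : k ≠ i) :
      Relator n (x i j hij * x j k hjk + x j k hjk * x k i hki + x k i hki * x i j hij)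
  | xy (i j k : Fin n) (hij : i ≠ j) (hjk : j ≠ k) (hki : k ≠ i) :
      Relator n (x i j hij * y j k hjk + x j k hjk * y k i hki + x k i hki * y i j hij
        + y i j hij * x j k hjk + y j k hjk * x k i hki + y k i hki * x i j hij)
  | yy (i j k : Fin n) (hij : i ≠ j) (hjk : j ≠ k) (hki : k ≠ i) :
      Relator n (y i j hij * y j k hjk + y j k hjk * y k i hki + y k i hki * y i j hij)
  | x_sq (i j : Fin n) (h : i ≠ j) : Relator n (x i j h ^ 2)
  | x_mul_y (i j : Fin n) (h : i ≠ j) : Relator n (x i j h * y i j h)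
  | y_sq (i j : Fin n) (h : i ≠ j) : Relator n (y i j h ^ 2)

end DoubleEvenOS

/-- The double even Orlik–Solomon algebra over `ℚ`: the commutative associative unital algebra
with generators `x_{ij}`, `y_{ij}` and the relations above. -/
abbrev DoubleEvenOS (n : ℕ) : Type :=
  MvPolynomial (DoubleOSGen n) ℚ ⧸ Ideal.span {p | DoubleEvenOS.Relator n p}

/-!
Both algebras have a basis indexed by the rooted forests on the vertices `1, …, n`, of which there
are `(n + 1) ^ (n - 1)`. The two cases are treated at once, for generators that commute up to a
sign `s = ±1`.

For every `t` the combinations `x_{ij} + t y_{ij}` satisfy the usual three-term relation of an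
Orlik–Solomon algebra. Give the vertices distinct parameters `t_v`, and attach to a directed edge
`v → w` the element `e_{vw} = x_{vw} + t_v y_{vw}`, whose parameter is that of its source. Then
`e_{vw}` and `e_{wv}` span the same space as `x_{vw}` and `y_{vw}`, and the relation for the
parameter `t_v` reads `e_{vw} e_{vu} = (e_{vw} - e_{vu}) z`, with `z` in the span of the generators
on `{w, u}`. A rooted forest, encoded by its parent function `p`, has the monomial
`∏ e_{v, p v}`, and these monomials form the basis.

*Spanning.* The product of a generator on `{a, b}` with the monomial of a forest is rewritten by
induction on the sum of the ranks (depths, say) of `a` and `b`: if `a` has a parent `q`, the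
relation above replaces the two edges out of `a` by one edge out of `a` times a generator on
`{b, q}`
(`IsDoubleSystem.gen_mul_mono_mem_aux`). Products in which a cycle occurs vanish
(`IsDoubleSystem.cycle_mul_mono_eq_zero`).

*Independence.* For each directed edge `i → j` there is a residue map that contracts the edge in
the forests containing it and kills all other forests; the choice of parameters makes it respect
the monomials up to sign (`IsUniversalDoubleSystem.exists_residue`). In a linear relation, consider
a forest with as many pairs (vertex, ancestor) as possible and a leaf `i` of it with parent `j`. All
other forests with the same contraction arise by moving siblings of `i` below `i`, so they have more
such pairs. Hence the residue isolates the coefficient of the forest, and induction on the number of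
edges applies (`IsUniversalDoubleSystem.linearIndependent_mono`).

*Counting.* The number of forests on `r + k` vertices with `r` prescribed roots is
`r (r + k) ^ (k - 1)`, by the recursion over the set of children of the roots
(`card_rootedMap`).
-/

/-! ### Systems of two-coloured generators -/

section Systems

variable {V B : Type} [Ring B] [Algebra ℚ B]

/-- The defining relations of the two double Orlik–Solomon algebras at once, for a family of
elements `g c v w` of a `ℚ`-algebra. The colour `c` is `false` for `x` and `true` for `y`; the sign
`s` is `-1` for odd and `1` for even generators. By convention `g c v v = 0`, which makes the
relations hold for vertices that need not be distinct. Putting `c = d` in `tri` gives twice the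
one-coloured relation. -/
structure IsDoubleSystem (s : ℚ) (g : Bool → V → V → B) : Prop where
  self (c : Bool) (v : V) : g c v v = 0
  swap (c : Bool) (v w : V) : g c w v = -(s • g c v w)
  comm (c d : Bool) (v w v' w' : V) : g c v w * g d v' w' = s • (g d v' w' * g c v w)
  tri (c d : Bool) (v w u : V) :
    g c v w * g d w u + g c w u * g d u v + g c u v * g d v w
      + g d v w * g c w u + g d w u * g c u v + g d u v * g c v w = 0
  sq (c d : Bool) (v w : V) : g c v w * g d v w = 0

namespace IsDoubleSystem

variable {s : ℚ} {g : Bool → V → V → B}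

/-- The three-term relation for pairwise distinct vertices implies it for all vertices. -/
theorem of_distinct (self : ∀ c v, g c v v = 0)
    (swap : ∀ c v w, g c w v = -(s • g c v w))
    (comm : ∀ c d v w v' w', g c v w * g d v' w' = s • (g d v' w' * g c v w))
    (tri : ∀ c d v w u, v ≠ w → w ≠ u → u ≠ v →
      g c v w * g d w u + g c w u * g d u v + g c u v * g d v w
        + g d v w * g c w u + g d w u * g c u v + g d u v * g c v w = 0)
    (sq : ∀ c d v w, g c v w * g d v w = 0) : IsDoubleSystem s g := by
  have key : ∀ c d v w, g c v w * g d w v = 0 := fun c d v w => by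
    rw [swap d v w, mul_neg, mul_smul_comm, sq, smul_zero, neg_zero]
  refine ⟨self, swap, comm, fun c d v w u => ?_, sq⟩
  by_cases h1 : v = w
  · subst h1; simp [self, key]
  by_cases h2 : w = u
  · subst h2; simp [self, key]
  by_cases h3 : u = v
  · subst h3; simp [self, key]
  exact tri c d v w u h1 h2 h3

/-- The three-term relation with all edges at `v` on the left-hand side; the sign `s` has
disappeared. -/
theorem mul_add_mul (hg : IsDoubleSystem s g) (hs : s * s = 1) (c d : Bool) (v w u : V) :
    g c v w * g d v u + g d v w * g c v u =
      (g c v w - g c v u) * g d w u + (g d v w - g d v u) * g c w u := by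
  have key : ∀ c d, ∀ a b : V, g c w u * g d a b = s • (g d a b * g c w u) :=
    fun c d a b => hg.comm c d w u a b
  have h1 : ∀ c d, g c w u * g d u v = -(g d v u * g c w u) := fun c d => by
    rw [hg.swap d v u, mul_neg, mul_smul_comm, key, smul_smul, hs, one_smul]
  have h2 : ∀ c d, g c u v * g d v w = -(g d v w * g c v u) := fun c d => by
    rw [hg.swap c v u, neg_mul, smul_mul_assoc, hg.comm c d, smul_smul, hs, one_smul]
  have h := hg.tri c d v w u
  rw [h1, h1, h2, h2] at h
  rw [← sub_eq_zero, ← neg_eq_zero, ← h]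
  simp only [sub_mul]
  abel

theorem mul_same (hg : IsDoubleSystem s g) (hs : s * s = 1) (c : Bool) (v w u : V) :
    g c v w * g c v u = (g c v w - g c v u) * g c w u := by
  have h := hg.mul_add_mul hs c c v w u
  rw [← two_smul ℚ, ← two_smul ℚ] at h
  exact smul_right_injective B (two_ne_zero (α := ℚ)) h

end IsDoubleSystem

end Systems

/-! ### Directed edges and monomials of parent functions -/

section Monomials

variable {n : ℕ} {B : Type} [Ring B] [Algebra ℚ B]

/-- The combination `x_{ab} + t y_{ab}`, a member of the pencil spanned by the two colours. -/
def pencil (g : Bool → Fin n → Fin n → B) (t : ℚ) (a b : Fin n) : B :=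
  g false a b + t • g true a b

/-- The element attached to a directed edge `v → w`: the member of the pencil on `{v, w}` whose
parameter is the source `v`. As parameters of distinct vertices differ, the elements of `v → w` and
`w → v` span the same space as `x_{vw}` and `y_{vw}`. -/
def dirEdge (g : Bool → Fin n → Fin n → B) (v w : Fin n) : B :=
  pencil g ((v : ℕ) : ℚ) v w

/-- The product of the edges `v → p v` over the vertices `v` of a list. The value `none` of the
parent function `p` marks a root. -/
def listMono (g : Bool → Fin n → Fin n → B) (p : Fin n → Option (Fin n)) (l : List (Fin n)) : B :=
  (l.map fun v => (p v).elim 1 (dirEdge g v)).prod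

/-- The monomial of a parent function: the product of all edges `v → p v`, in the order of their
sources. -/
def mono (g : Bool → Fin n → Fin n → B) (p : Fin n → Option (Fin n)) : B :=
  listMono g p (List.finRange n)

variable {s : ℚ} {g : Bool → Fin n → Fin n → B}

@[simp] theorem listMono_nil (p : Fin n → Option (Fin n)) : listMono g p [] = 1 := rfl

theorem listMono_cons (p : Fin n → Option (Fin n)) (v : Fin n) (l : List (Fin n)) :
    listMono g p (v :: l) = (p v).elim 1 (dirEdge g v) * listMono g p l := by
  simp [listMono]

theorem listMono_append (p : Fin n → Option (Fin n)) (l l' : List (Fin n)) :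
    listMono g p (l ++ l') = listMono g p l * listMono g p l' := by
  simp [listMono]

theorem listMono_congr {p q : Fin n → Option (Fin n)} {l : List (Fin n)}
    (h : ∀ v ∈ l, p v = q v) : listMono g p l = listMono g q l := by
  unfold listMono
  congr 1
  exact List.map_congr_left fun v hv => by rw [h v hv]

theorem mono_none : mono g (fun _ => none) = 1 := by
  simp [mono, listMono]

theorem exists_finRange_eq (a : Fin n) :
    ∃ l₁ l₂, List.finRange n = l₁ ++ a :: l₂ ∧ a ∉ l₁ ∧ a ∉ l₂ := by
  obtain ⟨l₁, l₂, h⟩ := List.append_of_mem (List.mem_finRange a)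
  have hn := List.nodup_finRange n
  rw [h, List.nodup_append] at hn
  refine ⟨l₁, l₂, h, fun hm => ?_, (List.nodup_cons.1 hn.2.1).1⟩
  exact hn.2.2 a hm a (by simp) rfl

namespace IsDoubleSystem

theorem pencil_swap (hg : IsDoubleSystem s g) (t : ℚ) (v w : Fin n) :
    pencil g t w v = -(s • pencil g t v w) := by
  rw [pencil, pencil, hg.swap false v w, hg.swap true v w]
  module

theorem gen_mul_pencil (hg : IsDoubleSystem s g) (c : Bool) (t : ℚ) (v w v' w' : Fin n) :
    g c v w * pencil g t v' w' = s • (pencil g t v' w' * g c v w) := by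
  simp only [pencil, mul_add, add_mul, mul_smul_comm, smul_mul_assoc, hg.comm c _ v w v' w']
  module

theorem pencil_mul_pencil (hg : IsDoubleSystem s g) (t t' : ℚ) (v w v' w' : Fin n) :
    pencil g t v w * pencil g t' v' w' = s • (pencil g t' v' w' * pencil g t v w) := by
  conv_lhs => rw [pencil]
  conv_rhs => rw [pencil.eq_def g t]
  simp only [mul_add, add_mul, mul_smul_comm, smul_mul_assoc, hg.gen_mul_pencil]
  module

/-- Each member of the pencil satisfies the one-coloured three-term relation. -/
theorem pencil_mul_same (hg : IsDoubleSystem s g) (hs : s * s = 1) (t : ℚ) (v w u : Fin n) :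
    pencil g t v w * pencil g t v u = (pencil g t v w - pencil g t v u) * pencil g t w u := by
  have h1 := hg.mul_same hs false v w u
  have h2 := hg.mul_same hs true v w u
  have h3 := hg.mul_add_mul hs false true v w u
  simp only [pencil, mul_add, add_mul, sub_mul, mul_smul_comm, smul_mul_assoc] at h1 h2 h3 ⊢
  linear_combination (norm := module) h1 + t • h3 + (t * t) • h2

/-- Anything that commutes with the directed edges up to the sign `s` commutes with monomials up
to a nonzero scalar. -/
theorem exists_mul_listMono (hs : s * s = 1) {G : B}
    (hG : ∀ v w, G * dirEdge g v w = s • (dirEdge g v w * G))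
    (p : Fin n → Option (Fin n)) (l : List (Fin n)) :
    ∃ t : ℚ, t ≠ 0 ∧ G * listMono g p l = t • (listMono g p l * G) := by
  induction l with
  | nil => exact ⟨1, one_ne_zero, by simp⟩
  | cons v l ih =>
    obtain ⟨t, ht, h⟩ := ih
    have hs0 : s ≠ 0 := by rintro rfl; simp at hs
    cases hv : p v with
    | none => exact ⟨t, ht, by simpa [listMono_cons, hv] using h⟩
    | some w =>
      refine ⟨s * t, mul_ne_zero hs0 ht, ?_⟩
      simp only [listMono_cons, hv, Option.elim_some]
      rw [← mul_assoc, hG, smul_mul_assoc, mul_assoc, h, mul_smul_comm, smul_smul, mul_assoc]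

/-- Giving a root `a` the parent `b` multiplies the monomial by the edge `a → b`. -/
theorem exists_mono_update (hg : IsDoubleSystem s g) (hs : s * s = 1)
    {p : Fin n → Option (Fin n)} {a : Fin n} (ha : p a = none) (b : Fin n) :
    ∃ t : ℚ, t ≠ 0 ∧ mono g (Function.update p a (some b)) = t • (dirEdge g a b * mono g p) := by
  obtain ⟨l₁, l₂, hl, h1, h2⟩ := exists_finRange_eq a
  obtain ⟨t, ht, h⟩ := exists_mul_listMono hs (G := dirEdge g a b)
    (fun v w => hg.pencil_mul_pencil _ _ _ _ _ _) p l₁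
  refine ⟨t⁻¹, inv_ne_zero ht, ?_⟩
  have e : ∀ l : List (Fin n), a ∉ l →
      listMono g (Function.update p a (some b)) l = listMono g p l := fun l hal =>
    listMono_congr fun v hv => Function.update_of_ne (fun hva : v = a => hal (hva ▸ hv)) _ _
  simp only [mono, hl, listMono_append, listMono_cons, e _ h1, e _ h2, ha, Option.elim_none,
    Function.update_self, Option.elim_some, one_mul]
  rw [← mul_assoc (dirEdge g a b), h, smul_mul_assoc, smul_smul, inv_mul_cancel₀ ht, one_smul,
    mul_assoc]

theorem exists_mono_eq (hg : IsDoubleSystem s g) (hs : s * s = 1)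
    {p : Fin n → Option (Fin n)} {a b : Fin n} (ha : p a = some b) :
    ∃ t : ℚ, t ≠ 0 ∧ mono g p = t • (dirEdge g a b * mono g (Function.update p a none)) := by
  obtain ⟨t, ht, h⟩ := hg.exists_mono_update hs (p := Function.update p a none) (a := a)
    (Function.update_self ..) b
  refine ⟨t, ht, ?_⟩
  rw [← h, Function.update_idem, ← ha, Function.update_eq_self]

end IsDoubleSystem

end Monomials

/-! ### Rooted forests as parent functions -/

section Forests

variable {V : Type}

/-- The function `h` strictly decreases along the edges `v → p v`. -/
def IsRank (p : V → Option V) (h : V → ℕ) : Prop :=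
  ∀ v w, p v = some w → h w < h v

/-- A parent function is a rooted forest if it has no directed cycle; this is expressed by the
existence of a rank function. -/
def IsForest (p : V → Option V) : Prop := ∃ h, IsRank p h

/-- `Anc p v w`: the vertex `w` is reached from `v` by going to parents. -/
def Anc (p : V → Option V) : V → V → Prop :=
  Relation.ReflTransGen fun v w => p v = some w

/-- Two vertices of a rooted forest are in the same tree iff they have a common ancestor. -/
def SameTree (p : V → Option V) (v w : V) : Prop := ∃ r, Anc p v r ∧ Anc p w r

theorem SameTree.symm {p : V → Option V} {v w : V} (h : SameTree p v w) : SameTree p w v :=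
  let ⟨r, h1, h2⟩ := h; ⟨r, h2, h1⟩

theorem SameTree.of_anc {p : V → Option V} {v w : V} (h : Anc p v w) : SameTree p v w :=
  ⟨w, h, Relation.ReflTransGen.refl⟩

theorem IsRank.anc_le {p : V → Option V} {h : V → ℕ} (hp : IsRank p h) {v w : V}
    (hvw : Anc p v w) : h w ≤ h v := by
  induction hvw with
  | refl => exact le_rfl
  | tail _ e ih => exact (hp _ _ e).le.trans ih

theorem IsRank.anc_antisymm {p : V → Option V} {h : V → ℕ} (hp : IsRank p h) {v w : V}
    (hvw : Anc p v w) (hwv : Anc p w v) : v = w := by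
  rcases Relation.ReflTransGen.cases_head hvw with e | ⟨u, e, hu⟩
  · exact e
  · have h1 := hp _ _ e
    have h2 := hp.anc_le hu
    have h3 := hp.anc_le hwv
    omega

variable [DecidableEq V]

theorem update_none_eq_some {p : V → Option V} {a v w : V}
    (h : Function.update p a none v = some w) : p v = some w := by
  by_cases hv : v = a
  · subst hv; simp at h
  · rwa [Function.update_of_ne hv] at h

theorem IsRank.update_none {p : V → Option V} {h : V → ℕ} (hp : IsRank p h) (a : V) :
    IsRank (Function.update p a none) h := fun v w e => hp v w (update_none_eq_some e)

theorem Anc.of_update_none {p : V → Option V} {a v w : V}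
    (h : Anc (Function.update p a none) v w) : Anc p v w :=
  Relation.ReflTransGen.mono (fun _ _ e => update_none_eq_some e) _ _ h

/-- A path to the root that avoids `a` survives the removal of the edge out of `a`. -/
theorem Anc.update_none {p : V → Option V} {a v w : V} (h : Anc p v w) (hva : ¬ Anc p v a) :
    Anc (Function.update p a none) v w := by
  induction h using Relation.ReflTransGen.head_induction_on with
  | refl => exact Relation.ReflTransGen.refl
  | @head v u e hu ih =>
    have hv : v ≠ a := by rintro rfl; exact hva Relation.ReflTransGen.refl
    refine Relation.ReflTransGen.head ?_ (ih fun hc => hva (Relation.ReflTransGen.head e hc))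
    rwa [Function.update_of_ne hv]

/-- If `b` and `c` are in one tree and `b` is not an ancestor of `c`, then `b` has a parent, and
this parent is still in one tree with `c` after the edge out of `b` is removed. -/
theorem SameTree.exists_parent {p : V → Option V} {h : V → ℕ} (hp : IsRank p h) {b c : V}
    (hbc : SameTree p b c) (hcb : ¬ Anc p c b) :
    ∃ q, p b = some q ∧ SameTree (Function.update p b none) c q := by
  obtain ⟨r, hbr, hcr⟩ := hbc
  rcases Relation.ReflTransGen.cases_head hbr with e | ⟨q, e, hq⟩
  · subst e; exact absurd hcr hcb
  · refine ⟨q, e, r, Anc.update_none hcr hcb, Anc.update_none hq fun hc => ?_⟩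
    have h1 := hp _ _ e
    have h2 := hp.anc_le hc
    omega

/-- Attaching a root `a` to a vertex that does not descend from it gives a forest. -/
theorem IsForest.update_some {p : V → Option V} (hp : IsForest p) {a b : V} (ha : p a = none)
    (hba : ¬ Anc p b a) : IsForest (Function.update p a (some b)) := by
  classical
  obtain ⟨h, hp⟩ := hp
  refine ⟨fun v => if Anc p v a then h v + h b + 1 else h v, fun v w e => ?_⟩
  by_cases hv : v = a
  · subst hv
    simp only [Function.update_self, Option.some.injEq] at e
    subst e
    have : Anc p v v := Relation.ReflTransGen.refl
    simp only [this, hba, if_true, if_false]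
    omega
  · rw [Function.update_of_ne hv] at e
    have h1 := hp _ _ e
    by_cases hw : Anc p w a
    · have hva : Anc p v a := Relation.ReflTransGen.head e hw
      simp only [hw, hva, if_true]
      omega
    · simp only [hw, if_false]
      split_ifs <;> omega

end Forests

/-! ### Vanishing of cycles -/

section Vanishing

variable {n : ℕ} {B : Type} [Ring B] [Algebra ℚ B] {s : ℚ} {g : Bool → Fin n → Fin n → B}

namespace IsDoubleSystem

/-- Moving a generator past an edge to a product that vanishes. -/
theorem gen_mul_pencil_mul_eq_zero (hg : IsDoubleSystem s g) (c : Bool) (t : ℚ)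
    (v w v' w' : Fin n) {m : B} (h : g c v w * m = 0) :
    g c v w * (pencil g t v' w' * m) = 0 := by
  rw [← mul_assoc, hg.gen_mul_pencil, smul_mul_assoc, mul_assoc, h, mul_zero, smul_zero]

theorem gen_swap_mul_eq_zero (hg : IsDoubleSystem s g) (c : Bool) (v w : Fin n) {m : B}
    (h : g c v w * m = 0) : g c w v * m = 0 := by
  rw [hg.swap, neg_mul, smul_mul_assoc, h, smul_zero, neg_zero]

/-- A generator, or a path of two generators, that closes a cycle with a rooted forest annihilates
its monomial. The two statements are proved together: one end of the path, say `b`, has a parent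
`q`, and the three-term relation for the two edges out of `b` replaces `b` by `q`, which has
smaller rank. This needs the first edge out of `b` to have the parameter of `b`. For arbitrary
colours, the product of `g d v c` and `g d' v b` is antisymmetric in `d` and `d'` modulo generators
on `{b, c}`, so that one pair of independent colours is enough. -/
theorem cycle_mul_mono_eq_zero (hg : IsDoubleSystem s g) (hs : s * s = 1) {h : Fin n → ℕ} (N : ℕ) :
    ∀ p, IsRank p h → ∀ b c, SameTree p b c → h b + h c < N →
      (∀ d, g d b c * mono g p = 0) ∧
      ∀ d d' v, g d v c * (g d' v b * mono g p) = 0 := by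
  induction N with
  | zero => intro _ _ _ _ _ hN; omega
  | succ N ih =>
    -- the case where `b` is not an ancestor of `c`
    have main : ∀ p, IsRank p h → ∀ b c, SameTree p b c → h b + h c < N + 1 → ¬ Anc p c b →
        (∀ d, g d b c * mono g p = 0) ∧ ∀ d d' v, g d v c * (g d' v b * mono g p) = 0 := by
      intro p hp b c hbc hN hcb
      obtain ⟨q, hq, hcq⟩ := hbc.exists_parent hp hcb
      have hlt := hp _ _ hq
      have IH := (ih _ (hp.update_none b) c q hcq (by omega)).2
      have IH' := (ih _ (hp.update_none b) q c hcq.symm (by omega)).2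
      obtain ⟨t, -, ht⟩ := hg.exists_mono_eq hs hq
      set m := mono g (Function.update p b none) with hm
      have Z : ∀ d, g d b c * mono g p = 0 := fun d => by
        rw [ht, mul_smul_comm]
        simp only [dirEdge, pencil, add_mul, mul_add, smul_mul_assoc, mul_smul_comm, IH']
        simp
      refine ⟨Z, ?_⟩
      -- the colour at `v b` is the one of the edges out of `b`
      have E : ∀ d v, g d v c * (dirEdge g b v * mono g p) = 0 := fun d v => by
        have hz : ∀ t', g d v c * (pencil g t' v q * m) = 0 := fun t' => by
          simp only [pencil, add_mul, mul_add, smul_mul_assoc, mul_smul_comm, IH']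
          simp
        rw [ht, mul_smul_comm, ← mul_assoc (dirEdge g b v), dirEdge, dirEdge,
          hg.pencil_mul_same hs, sub_mul, sub_mul, mul_smul_comm, mul_sub, mul_assoc, mul_assoc,
          hg.gen_mul_pencil_mul_eq_zero _ _ _ _ _ _ (hz _),
          hg.gen_mul_pencil_mul_eq_zero _ _ _ _ _ _ (hz _), sub_zero, smul_zero]
      have E' : ∀ d v, g d v c * (g false v b * mono g p)
          + ((b : ℕ) : ℚ) • (g d v c * (g true v b * mono g p)) = 0 := fun d v => by
        have := E d v
        rw [dirEdge, hg.pencil_swap _ v b, neg_mul, mul_neg, smul_mul_assoc, mul_smul_comm,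
          neg_eq_zero] at this
        have hs0 : s ≠ 0 := by rintro rfl; simp at hs
        have h2 := (smul_eq_zero.1 this).resolve_left hs0
        rw [← h2]
        simp only [pencil, add_mul, mul_add, smul_mul_assoc, mul_smul_comm]
      have Z' : ∀ d, g d c b * mono g p = 0 := fun d => hg.gen_swap_mul_eq_zero _ _ _ (Z d)
      have S : ∀ d v, g d v c * (g d v b * mono g p) = 0 := fun d v => by
        rw [← mul_assoc, hg.mul_same hs, mul_assoc, Z', mul_zero]
      have TF : ∀ v, g true v c * (g false v b * mono g p) = 0 := fun v => by
        have := E' true v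
        rwa [S, smul_zero, add_zero] at this
      have FT : ∀ v, g false v c * (g true v b * mono g p) = 0 := fun v => by
        have := congrArg (· * mono g p) (hg.mul_add_mul hs false true v c b)
        simpa [add_mul, mul_assoc, Z', TF] using this
      rintro (_ | _) (_ | _) v
      exacts [S _ v, FT v, TF v, S _ v]
    intro p hp b c hbc hN
    by_cases hcb : Anc p c b
    · by_cases hbc' : Anc p b c
      · have := hp.anc_antisymm hcb hbc'
        subst this
        refine ⟨fun d => by rw [hg.self, zero_mul], fun d d' v => ?_⟩
        rw [← mul_assoc, hg.sq, zero_mul]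
      · obtain ⟨h1, h2⟩ := main p hp c b hbc.symm (by omega) hbc'
        refine ⟨fun d => hg.gen_swap_mul_eq_zero _ _ _ (h1 d), fun d d' v => ?_⟩
        rw [← mul_assoc, hg.comm, smul_mul_assoc, mul_assoc, h2, smul_zero]
    · exact main p hp b c hbc hN hcb

/-- A generator inside one tree of a rooted forest annihilates its monomial. -/
theorem gen_mul_mono_eq_zero (hg : IsDoubleSystem s g) (hs : s * s = 1)
    {p : Fin n → Option (Fin n)} (hp : IsForest p) {b c : Fin n} (hbc : SameTree p b c) (d : Bool) :
    g d b c * mono g p = 0 :=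
  let ⟨h, hh⟩ := hp
  (hg.cycle_mul_mono_eq_zero hs (h := h) (h b + h c + 1) p hh b c hbc (by omega)).1 d

theorem pencil_mul_mono_eq_zero (hg : IsDoubleSystem s g) (hs : s * s = 1)
    {p : Fin n → Option (Fin n)} (hp : IsForest p) {b c : Fin n} (hbc : SameTree p b c) (t : ℚ) :
    pencil g t b c * mono g p = 0 := by
  rw [pencil, add_mul, smul_mul_assoc, hg.gen_mul_mono_eq_zero hs hp hbc,
    hg.gen_mul_mono_eq_zero hs hp hbc, smul_zero, add_zero]

/-! ### Rooted forests span -/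

/-- Multiplying by an edge out of a root gives a forest monomial or zero. -/
theorem dirEdge_mul_mono_mem (hg : IsDoubleSystem s g) (hs : s * s = 1)
    {p : Fin n → Option (Fin n)} (hp : IsForest p) {a : Fin n} (ha : p a = none) (b : Fin n)
    {S : Submodule ℚ B}
    (hS : IsForest (Function.update p a (some b)) → mono g (Function.update p a (some b)) ∈ S) :
    dirEdge g a b * mono g p ∈ S := by
  by_cases hba : Anc p b a
  · rw [dirEdge, hg.pencil_mul_mono_eq_zero hs hp (SameTree.of_anc hba).symm]
    exact S.zero_mem
  · obtain ⟨t, ht, h⟩ := hg.exists_mono_update hs ha b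
    have := S.smul_mem t⁻¹ (hS (hp.update_some ha hba))
    rwa [h, smul_smul, inv_mul_cancel₀ ht, one_smul] at this

/-- The generators on `{a, b}` are combinations of the two directed edges. -/
theorem gen_mul_mem (hg : IsDoubleSystem s g) {a b : Fin n} (hab : a ≠ b) {m : B}
    {S : Submodule ℚ B} (h1 : dirEdge g a b * m ∈ S) (h2 : dirEdge g b a * m ∈ S) (d : Bool) :
    g d a b * m ∈ S := by
  have hne : ((a : ℕ) : ℚ) - ((b : ℕ) : ℚ) ≠ 0 := by
    rw [sub_ne_zero]
    exact fun h => hab (Fin.ext (by exact_mod_cast h))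
  have h3 : pencil g ((b : ℕ) : ℚ) a b * m ∈ S := by
    have : pencil g ((b : ℕ) : ℚ) a b * m = -(s • (dirEdge g b a * m)) := by
      rw [hg.pencil_swap _ b a, dirEdge, neg_mul, smul_mul_assoc]
    rw [this]
    exact S.neg_mem (S.smul_mem _ h2)
  simp only [dirEdge, pencil, add_mul, smul_mul_assoc] at h1 h3
  have ht : g true a b * m ∈ S := by
    have := S.smul_mem (((a : ℕ) : ℚ) - ((b : ℕ) : ℚ))⁻¹ (S.sub_mem h1 h3)
    rwa [add_sub_add_left_eq_sub, ← sub_smul, smul_smul, inv_mul_cancel₀ hne, one_smul] at this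
  cases d with
  | true => exact ht
  | false => simpa using S.sub_mem h1 (S.smul_mem ((a : ℕ) : ℚ) ht)

/-- A generator times a forest monomial is a combination of forest monomials, in which every root
outside the two trees that are joined remains a root. This control of the roots makes the induction
work: if `a` has the parent `q`, then the edge `a → b` times the edge `a → q` is the difference of
the two times a combination of the generators on `{b, q}`, and after joining `b` and `q` the vertex
`a` is still a root. -/
theorem gen_mul_mono_mem_aux (hg : IsDoubleSystem s g) (hs : s * s = 1) {h : Fin n → ℕ} (N : ℕ) :
    ∀ p, IsRank p h → ∀ a b, h a + h b < N → ∀ d, g d a b * mono g p ∈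
      Submodule.span ℚ (mono g '' {q | IsForest q ∧
        ∀ v, p v = none → ¬ Anc p a v → ¬ Anc p b v → q v = none}) := by
  induction N with
  | zero => intro _ _ _ _ hN; omega
  | succ N ih =>
    -- the edge directed from `a` to `b`
    have main : ∀ p, IsRank p h → ∀ a b, h a + h b < N + 1 → ¬ SameTree p a b →
        dirEdge g a b * mono g p ∈ Submodule.span ℚ (mono g '' {q | IsForest q ∧
          ∀ v, p v = none → ¬ Anc p a v → ¬ Anc p b v → q v = none}) := by
      intro p hp a b hN hab
      have hba : ¬ Anc p b a := fun hc => hab (SameTree.of_anc hc).symm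
      cases ha : p a with
      | none =>
        refine hg.dirEdge_mul_mono_mem hs ⟨h, hp⟩ ha b fun hf => Submodule.subset_span
          ⟨_, ⟨hf, fun v hv hav _ => ?_⟩, rfl⟩
        rwa [Function.update_of_ne]
        rintro rfl
        exact hav Relation.ReflTransGen.refl
      | some q =>
        have hlt := hp _ _ ha
        obtain ⟨t, -, ht⟩ := hg.exists_mono_eq hs ha
        have IH := ih _ (hp.update_none a) b q (by omega)
        set T := Submodule.span ℚ (mono g '' {q | IsForest q ∧
          ∀ v, p v = none → ¬ Anc p a v → ¬ Anc p b v → q v = none}) with hT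
        -- `a` is a root in every forest that occurs in the product for `b` and `q`
        have step : ∀ w, dirEdge g a w * (pencil g ((a : ℕ) : ℚ) b q *
            mono g (Function.update p a none)) ∈ T := by
          intro w
          have hz := Submodule.add_mem _ (IH false)
            (Submodule.smul_mem _ ((a : ℕ) : ℚ) (IH true))
          rw [← smul_mul_assoc, ← add_mul, ← pencil] at hz
          refine Submodule.span_induction (p := fun x _ => dirEdge g a w * x ∈ T) ?_ ?_ ?_ ?_ hz
          · rintro _ ⟨r, ⟨hr, hroot⟩, rfl⟩
            have hra : r a = none := by
              refine hroot a (Function.update_self ..) (fun hc => hba hc.of_update_none)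
                fun hc => ?_
              have := hp.anc_le hc.of_update_none
              omega
            refine hg.dirEdge_mul_mono_mem hs hr hra w fun hf => Submodule.subset_span
              ⟨_, ⟨hf, fun v hv hav hbv => ?_⟩, rfl⟩
            have hva : v ≠ a := by rintro rfl; exact hav Relation.ReflTransGen.refl
            rw [Function.update_of_ne hva]
            refine hroot v (by rwa [Function.update_of_ne hva]) (fun hc => hbv hc.of_update_none)
              fun hc => hav (Relation.ReflTransGen.head ha hc.of_update_none)
          · rw [mul_zero]; exact Submodule.zero_mem _
          · intro x y _ _ hx hy
            rw [mul_add]; exact Submodule.add_mem _ hx hy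
          · intro c x _ hx
            rw [mul_smul_comm]; exact Submodule.smul_mem _ _ hx
        rw [ht, mul_smul_comm, ← mul_assoc (dirEdge g a b), dirEdge, dirEdge,
          hg.pencil_mul_same hs, mul_assoc, sub_mul]
        exact Submodule.smul_mem _ _ (Submodule.sub_mem _ (step b) (step q))
    intro p hp a b hN d
    by_cases hab : SameTree p a b
    · rw [hg.gen_mul_mono_eq_zero hs ⟨h, hp⟩ hab]
      exact Submodule.zero_mem _
    · refine hg.gen_mul_mem ?_ (main p hp a b hN hab) ?_ d
      · rintro rfl
        exact hab (SameTree.of_anc Relation.ReflTransGen.refl)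
      · refine Submodule.span_mono (Set.image_mono ?_)
          (main p hp b a (by omega) fun hc => hab hc.symm)
        exact fun q hq => ⟨hq.1, fun v hv hav hbv => hq.2 v hv hbv hav⟩

theorem gen_mul_mono_mem (hg : IsDoubleSystem s g) (hs : s * s = 1)
    {p : Fin n → Option (Fin n)} (hp : IsForest p) (d : Bool) (a b : Fin n) :
    g d a b * mono g p ∈ Submodule.span ℚ (mono g '' {q | IsForest q}) := by
  obtain ⟨h, hh⟩ := hp
  exact Submodule.span_mono (Set.image_mono fun q hq => hq.1)
    (hg.gen_mul_mono_mem_aux hs (h := h) (h a + h b + 1) p hh a b (by omega) d)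

/-- If the generators generate the algebra, then the monomials of rooted forests span it. -/
theorem span_mono_eq_top (hg : IsDoubleSystem s g) (hs : s * s = 1)
    (gen : ∀ S : Subalgebra ℚ B, (∀ c v w, g c v w ∈ S) → S = ⊤) :
    Submodule.span ℚ (mono g '' {q | IsForest q}) = ⊤ := by
  set M := Submodule.span ℚ (mono g '' {q | IsForest q}) with hM
  let S : Subalgebra ℚ B :=
    { carrier := {r | ∀ m ∈ M, r * m ∈ M}
      mul_mem' := fun {a b} ha hb m hm => by rw [mul_assoc]; exact ha _ (hb _ hm)
      add_mem' := fun {a b} ha hb m hm => by rw [add_mul]; exact M.add_mem (ha _ hm) (hb _ hm)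
      algebraMap_mem' := fun t m hm => by rw [← Algebra.smul_def]; exact M.smul_mem _ hm }
  have hS : S = ⊤ := gen S fun c v w m hm => by
    refine Submodule.span_induction (p := fun x _ => g c v w * x ∈ M) ?_ ?_ ?_ ?_ hm
    · rintro _ ⟨p, hp, rfl⟩
      exact hg.gen_mul_mono_mem hs hp c v w
    · rw [mul_zero]; exact M.zero_mem
    · intro x y _ _ hx hy
      rw [mul_add]; exact M.add_mem hx hy
    · intro t x _ hx
      rw [mul_smul_comm]; exact M.smul_mem _ hx
  have h1 : (1 : B) ∈ M :=
    Submodule.subset_span ⟨fun _ => none, ⟨fun _ => 0, fun _ _ e => by simp at e⟩, mono_none⟩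
  refine eq_top_iff.2 fun r _ => ?_
  have hr : r ∈ S := hS ▸ Algebra.mem_top
  simpa using hr 1 h1

end IsDoubleSystem

end Vanishing

/-! ### Contracting an edge -/

section Merging

/-- The map sending `i` to `j` and fixing all other vertices. -/
def mergeMap {V : Type} [DecidableEq V] (i j v : V) : V := if v = i then j else v

/-- The parent function obtained from `p` by contracting the edge `i → j`: children of `i` become
children of `j`, and `i` is left as an isolated root. -/
def contract {V : Type} [DecidableEq V] (i j : V) (p : V → Option V) (v : V) : Option V :=
  if v = i then none else (p v).map (mergeMap i j)

/-- The generator system of `2 × 2` upper triangular matrices in which `i` is merged with `j` on the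
diagonal, while the edge between them is recorded off the diagonal by the scalars `α`. The sign `s`
in the lower right corner makes the off-diagonal unit commute with the diagonal part up to `s`. -/
def mergeGen {V B : Type} [DecidableEq V] [Ring B] [Algebra ℚ B] (s : ℚ) (g : Bool → V → V → B)
    (i j : V) (α : Bool → ℚ) (c : Bool) (v w : V) : Matrix (Fin 2) (Fin 2) B :=
  !![g c (mergeMap i j v) (mergeMap i j w),
      algebraMap ℚ B (if v = i ∧ w = j then α c else if v = j ∧ w = i then -(s * α c) else 0);
    0, s • g c (mergeMap i j v) (mergeMap i j w)]

variable {V B : Type} [DecidableEq V] [Ring B] [Algebra ℚ B] {s : ℚ} {g : Bool → V → V → B}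

theorem IsDoubleSystem.mergeGen (hg : IsDoubleSystem s g) (hs : s * s = 1) {i j : V} (hij : i ≠ j)
    (α : Bool → ℚ) : IsDoubleSystem s (mergeGen s g i j α) := by
  set π := mergeMap i j with hπ
  obtain ⟨ξ, hξ⟩ : ∃ ξ : Bool → V → V → ℚ, ξ = fun c v w =>
    if v = i ∧ w = j then α c else if v = j ∧ w = i then -(s * α c) else 0 := ⟨_, rfl⟩
  have hG : ∀ c v w, _root_.mergeGen s g i j α c v w =
      !![g c (π v) (π w), algebraMap ℚ B (ξ c v w); 0, s • g c (π v) (π w)] := fun c v w => by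
    rw [hξ]; rfl
  have ξswap : ∀ c v w, ξ c w v = -(s * ξ c v w) := by
    intro c v w
    simp only [hξ]
    by_cases h1 : v = i <;> by_cases h2 : v = j <;> by_cases h3 : w = i <;> by_cases h4 : w = j <;>
      simp_all [← mul_assoc]
  have ξπ : ∀ c v w, ξ c v w = 0 ∨ π v = π w := by
    intro c v w
    simp only [hξ, hπ, mergeMap]
    split_ifs with h1 h2 <;> simp_all
  -- the off-diagonal entry sees the two other edges of a triangle with opposite signs
  have key : ∀ c d v w u, ξ c v w • (s • g d (π w) (π u) + g d (π u) (π v)) = 0 := by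
    intro c d v w u
    rcases ξπ c v w with h | h
    · rw [h, zero_smul]
    · rw [h, hg.swap d (π w) (π u), add_neg_cancel, smul_zero]
  have ξg : ∀ c d v w, ξ c v w • g d (π v) (π w) = 0 := by
    intro c d v w
    rcases ξπ c v w with h | h
    · rw [h, zero_smul]
    · rw [h, hg.self, smul_zero]
  have ξself : ∀ c v, ξ c v v = 0 := by
    intro c v
    simp only [hξ]
    rw [if_neg, if_neg] <;> rintro ⟨rfl, h⟩
    exacts [hij h.symm, hij h]
  have ext : ∀ a b c d a' b' c' d' : B, a = a' → b = b' → c = c' → d = d' →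
      (!![a, b; c, d] : Matrix (Fin 2) (Fin 2) B) = !![a', b'; c', d'] := by
    rintro a b c d _ _ _ _ rfl rfl rfl rfl; rfl
  have zero : (0 : Matrix (Fin 2) (Fin 2) B) = !![0, 0; 0, 0] := by
    ext a b; fin_cases a <;> fin_cases b <;> rfl
  refine ⟨fun c v => ?_, fun c v w => ?_, fun c d v w v' w' => ?_, fun c d v w u => ?_,
    fun c d v w => ?_⟩
  · rw [hG, zero, hg.self, ξself, map_zero, smul_zero]
  · rw [hG, hG, Matrix.smul_of, Matrix.neg_of]
    simp only [Matrix.smul_cons, Matrix.smul_empty, Matrix.neg_cons, Matrix.neg_empty]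
    refine ext _ _ _ _ _ _ _ _ (hg.swap ..) ?_ (by simp) ?_
    · rw [ξswap, map_neg, map_mul, Algebra.smul_def]
    · rw [hg.swap, smul_neg]
  · rw [hG, hG, Matrix.mul_fin_two, Matrix.mul_fin_two, Matrix.smul_of]
    simp only [Matrix.smul_cons, Matrix.smul_empty]
    refine ext _ _ _ _ _ _ _ _ (by simp [hg.comm c d]) ?_ (by simp) ?_
    · simp only [Algebra.algebraMap_eq_smul_one, mul_smul_comm, smul_mul_assoc, mul_one, one_mul,
        smul_add, smul_smul]
      rw [← mul_assoc s s, hs, one_mul, add_comm]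
    · simp only [zero_mul, zero_add, smul_mul_assoc, mul_smul_comm, hg.comm c d]
  · simp only [hG, Matrix.mul_fin_two, Matrix.of_add_of, zero, Matrix.cons_add_cons,
      Matrix.empty_add_empty]
    have tri := hg.tri c d (π v) (π w) (π u)
    refine ext _ _ _ _ _ _ _ _ (by simpa using tri) ?_ (by simp) ?_
    · simp only [Algebra.algebraMap_eq_smul_one, mul_smul_comm, smul_mul_assoc, mul_one, one_mul]
      linear_combination (norm := module) key c d v w u + key c d w u v + key c d u v w
        + key d c v w u + key d c w u v + key d c u v w
    · simpa [← smul_add, smul_smul, hs] using tri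
  · rw [hG, hG, Matrix.mul_fin_two, zero]
    refine ext _ _ _ _ _ _ _ _ (by simp [hg.sq]) ?_ (by simp) (by simp [hg.sq])
    simp only [Algebra.algebraMap_eq_smul_one, mul_smul_comm, smul_mul_assoc, mul_one, one_mul]
    rw [ξg d c, zero_add, ξg c d, smul_zero]

end Merging

/-! ### Linear independence of rooted forests -/

section Independence

variable {n : ℕ} {R : Type} [Ring R] [Algebra ℚ R] {s : ℚ} {g : Bool → Fin n → Fin n → R}

/-- An algebra with a system of generators that is universal among all algebras with such a
system. -/
structure IsUniversalDoubleSystem (s : ℚ) (g : Bool → Fin n → Fin n → R) : Prop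
    extends IsDoubleSystem s g where
  gen (S : Subalgebra ℚ R) : (∀ c v w, g c v w ∈ S) → S = ⊤
  lift (B : Type) [Ring B] [Algebra ℚ B] (g' : Bool → Fin n → Fin n → B) :
    IsDoubleSystem s g' → ∃ f : R →ₐ[ℚ] B, ∀ c v w, f (g c v w) = g' c v w

namespace IsUniversalDoubleSystem

theorem one_ne_zero (hg : IsUniversalDoubleSystem s g) : (1 : R) ≠ 0 := by
  obtain ⟨f, -⟩ := hg.lift ℚ (fun _ _ _ => 0) ⟨by simp, by simp, by simp, by simp, by simp⟩
  intro h
  have := map_one f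
  rw [h, map_zero] at this
  exact zero_ne_one this

/-- The residue along the edge `i → j`: a linear map that contracts this edge in the monomials that
contain it and kills all other monomials. It is the off-diagonal entry of the homomorphism to
matrices given by `mergeGen`, for scalars that give `i → j` the value `1` and `j → i` the
value `0`. -/
theorem exists_residue (hg : IsUniversalDoubleSystem s g) (hs : s * s = 1) {i j : Fin n}
    (hij : i ≠ j) :
    ∃ b : R →ₗ[ℚ] R, (∀ p, p i ≠ some j → b (mono g p) = 0) ∧
      ∀ p, p i = some j → ∃ t : ℚ, t ≠ 0 ∧ b (mono g p) = t • mono g (contract i j p) := by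
  have hne : ((i : ℕ) : ℚ) - ((j : ℕ) : ℚ) ≠ 0 := by
    rw [sub_ne_zero]
    exact fun h => hij (Fin.ext (by exact_mod_cast h))
  set α : Bool → ℚ := fun c =>
    bif c then (((i : ℕ) : ℚ) - ((j : ℕ) : ℚ))⁻¹
      else -((j : ℕ) : ℚ) * (((i : ℕ) : ℚ) - ((j : ℕ) : ℚ))⁻¹ with hα
  have α1 : α false + ((i : ℕ) : ℚ) * α true = 1 := by
    simp only [hα, cond_true, cond_false]
    field_simp
    ring
  have α0 : α false + ((j : ℕ) : ℚ) * α true = 0 := by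
    simp only [hα, cond_true, cond_false]
    ring
  obtain ⟨f, hf⟩ := hg.lift _ _ (hg.toIsDoubleSystem.mergeGen hs hij α)
  set π := mergeMap i j with hπ
  let b : R →ₗ[ℚ] R := (Matrix.entryLinearMap ℚ R 0 1).comp f.toLinearMap
  let d : R →ₗ[ℚ] R := (Matrix.entryLinearMap ℚ R 1 1).comp f.toLinearMap
  have b_one : b 1 = 0 := by simp [b]
  have d_one : d 1 = 1 := by simp [d]
  have d_gen : ∀ c v w m, d (g c v w * m) = s • (g c (π v) (π w) * d m) := by
    intro c v w m
    simp only [d, LinearMap.comp_apply, AlgHom.toLinearMap_apply, map_mul, hf, mergeGen,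
      Matrix.entryLinearMap_apply, Matrix.mul_apply, Fin.sum_univ_two]
    simp [hπ]
  have b_gen : ∀ c v w m, b (g c v w * m) = g c (π v) (π w) * b m +
      (if v = i ∧ w = j then α c else if v = j ∧ w = i then -(s * α c) else 0) • d m := by
    intro c v w m
    simp only [b, d, LinearMap.comp_apply, AlgHom.toLinearMap_apply, map_mul, hf, mergeGen,
      Matrix.entryLinearMap_apply, Matrix.mul_apply, Fin.sum_univ_two, Algebra.smul_def]
    simp [hπ]
  have d_edge : ∀ v w m, d (dirEdge g v w * m) =
      s • (pencil g ((v : ℕ) : ℚ) (π v) (π w) * d m) := by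
    intro v w m
    simp only [dirEdge, pencil, add_mul, smul_mul_assoc, map_add, map_smul, d_gen]
    module
  have b_edge : ∀ v w m, b (dirEdge g v w * m) = pencil g ((v : ℕ) : ℚ) (π v) (π w) * b m +
      (if v = i ∧ w = j then (1 : ℚ) else 0) • d m := by
    intro v w m
    simp only [dirEdge, pencil, add_mul, smul_mul_assoc, map_add, map_smul, b_gen]
    split_ifs with h1 h2
    · rw [h1.1]
      have h := congrArg (· • d m) α1
      linear_combination (norm := module) h
    · rw [h2.1]
      have h := congrArg (· • d m) α0
      linear_combination (norm := module) (-s) • h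
    · module
  have hs0 : s ≠ 0 := by rintro rfl; simp at hs
  have hπi : ∀ v, v ≠ i → π v = v := fun v hv => if_neg hv
  -- the diagonal part contracts, and the off-diagonal part vanishes without the edge `i → j`
  have d_list : ∀ p (l : List (Fin n)), i ∉ l →
      ∃ t : ℚ, t ≠ 0 ∧ d (listMono g p l) = t • listMono g (contract i j p) l := by
    intro p l
    induction l with
    | nil => exact fun _ => ⟨1, _root_.one_ne_zero, by simp [d_one]⟩
    | cons v l ih =>
      intro hl
      obtain ⟨hv, hl⟩ := not_or.1 (List.mem_cons.not.1 hl)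
      obtain ⟨t, ht, h⟩ := ih hl
      have hc : contract i j p v = (p v).map π := if_neg (Ne.symm hv)
      rw [listMono_cons, listMono_cons, hc]
      cases p v with
      | none => exact ⟨t, ht, by simpa using h⟩
      | some w =>
        refine ⟨s * t, mul_ne_zero hs0 ht, ?_⟩
        simp only [Option.elim_some, Option.map_some]
        rw [d_edge, h, hπi v (Ne.symm hv), mul_smul_comm, smul_smul, dirEdge]
  have b_list_zero : ∀ p (l : List (Fin n)), (i ∈ l → p i ≠ some j) → b (listMono g p l) = 0 := by
    intro p l
    induction l with
    | nil => exact fun _ => b_one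
    | cons v l ih =>
      intro hl
      have h := ih fun hm => hl (List.mem_cons_of_mem _ hm)
      rw [listMono_cons]
      cases hv : p v with
      | none => simpa using h
      | some w =>
        rw [Option.elim_some, b_edge, h, mul_zero, zero_add, if_neg, zero_smul]
        rintro ⟨rfl, rfl⟩
        exact hl (by simp) hv
  have b_list : ∀ p (l : List (Fin n)) m, i ∉ l →
      b (listMono g p l * m) = listMono g (contract i j p) l * b m := by
    intro p l m
    induction l with
    | nil => simp
    | cons v l ih =>
      intro hl
      obtain ⟨hv, hl⟩ := not_or.1 (List.mem_cons.not.1 hl)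
      have h := ih hl
      have hc : contract i j p v = (p v).map π := if_neg (Ne.symm hv)
      rw [listMono_cons, listMono_cons, hc, mul_assoc, mul_assoc]
      cases p v with
      | none => simpa using h
      | some w =>
        simp only [Option.elim_some, Option.map_some]
        rw [b_edge, h, hπi v (Ne.symm hv), if_neg fun h => hv h.1.symm, zero_smul, add_zero,
          dirEdge]
  refine ⟨b, fun p hp => b_list_zero p _ fun _ => hp, fun p hp => ?_⟩
  obtain ⟨l₁, l₂, hl, h1, h2⟩ := exists_finRange_eq i
  obtain ⟨t, ht, h⟩ := d_list p l₂ h2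
  have hc : contract i j p i = none := if_pos rfl
  refine ⟨t, ht, ?_⟩
  rw [mono, mono, hl, listMono_append, listMono_append, listMono_cons, listMono_cons, hc, hp,
    b_list _ _ _ h1, Option.elim_some, b_edge, b_list_zero _ _ fun hm => absurd hm h2, h]
  simp

end IsUniversalDoubleSystem

end Independence

section Contraction

variable {V : Type} [DecidableEq V]

theorem IsRank.contract {p : V → Option V} {h : V → ℕ} (hp : IsRank p h) {i j : V}
    (hi : p i = some j) : IsRank (contract i j p) h := by
  intro v w e
  by_cases hv : v = i
  · simp [_root_.contract, hv] at e
  · simp only [_root_.contract, if_neg hv, Option.map_eq_some_iff] at e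
    obtain ⟨u, hu, rfl⟩ := e
    have h1 := hp _ _ hu
    unfold mergeMap
    split_ifs with h2
    · subst h2
      exact (hp _ _ hi).trans h1
    · exact h1

/-- Suppose that two forests contain the edge `i → j` and have the same contraction, and that `i` is
a leaf of the first one. Then the second arises from the first by moving some siblings of `i`
below `i`, so that ancestors are preserved. -/
theorem Anc.of_contract_eq {p q : V → Option V} {i j : V} (hp : ∀ v, p v ≠ some i)
    (hpi : p i = some j) (hqi : q i = some j) (hpq : contract i j p = contract i j q) {v w : V}
    (h : Anc p v w) : Anc q v w := by
  refine Relation.ReflTransGen.lift' id (fun v w e => ?_) _ _ h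
  by_cases hv : v = i
  · subst hv
    rw [hpi] at e
    exact Relation.ReflTransGen.single (hqi.trans e)
  · have h1 := congrFun hpq v
    simp only [contract, if_neg hv, e, Option.map_some] at h1
    have hw : w ≠ i := by rintro rfl; exact hp v e
    obtain ⟨u, hu, huw⟩ := Option.map_eq_some_iff.1 h1.symm
    rw [mergeMap, mergeMap, if_neg hw] at huw
    split_ifs at huw with hui
    · subst hui huw
      exact Relation.ReflTransGen.head hu (Relation.ReflTransGen.single hqi)
    · subst huw
      exact Relation.ReflTransGen.single hu

/-- In the situation of `Anc.of_contract_eq`, if `i` is a leaf of the second forest as well, then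
the two forests agree. -/
theorem eq_of_contract_eq {p q : V → Option V} {i j : V} (hp : ∀ v, p v ≠ some i)
    (hq : ∀ v, q v ≠ some i) (hpi : p i = some j) (hqi : q i = some j)
    (hpq : contract i j p = contract i j q) : p = q := by
  have key : ∀ r : V → Option V, (∀ v, r v ≠ some i) → ∀ v, (r v).map (mergeMap i j) = r v := by
    intro r hr v
    cases hv : r v with
    | none => rfl
    | some w =>
      have hw : w ≠ i := by rintro rfl; exact hr v hv
      simp [mergeMap, hw]
  funext v
  by_cases hv : v = i
  · rw [hv, hpi, hqi]
  · have h1 := congrFun hpq v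
    simp only [contract, if_neg hv] at h1
    rwa [key p hp, key q hq] at h1

end Contraction

section Independence

open scoped Classical in
/-- The number of pairs consisting of a vertex and one of its ancestors. -/
noncomputable def ancCount {n : ℕ} (p : Fin n → Option (Fin n)) : ℕ :=
  (Finset.univ.filter fun vw : Fin n × Fin n => Anc p vw.1 vw.2).card

/-- The number of edges. -/
def edgeCount {n : ℕ} (p : Fin n → Option (Fin n)) : ℕ :=
  (Finset.univ.filter fun v => p v ≠ none).card

variable {n : ℕ} {R : Type} [Ring R] [Algebra ℚ R] {s : ℚ} {g : Bool → Fin n → Fin n → R}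

theorem edgeCount_contract_lt {p : Fin n → Option (Fin n)} {i j : Fin n} (hi : p i = some j) :
    edgeCount (contract i j p) < edgeCount p := by
  refine Finset.card_lt_card (Finset.ssubset_iff_of_subset ?_ |>.2 ⟨i, ?_, ?_⟩)
  · intro v hv
    refine Finset.mem_filter.2 ⟨Finset.mem_univ _, fun h => (Finset.mem_filter.1 hv).2 ?_⟩
    simp [contract, h]
  · simp [hi]
  · simp [contract]

theorem ancCount_lt {p q : Fin n → Option (Fin n)} {i j : Fin n} (hp : ∀ v, p v ≠ some i)
    (hpi : p i = some j) (hqi : q i = some j) (hpq : contract i j p = contract i j q)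
    (hne : p ≠ q) (hq : IsForest q) : ancCount p < ancCount q := by
  classical
  have : ∃ v, q v = some i := by
    by_contra hc
    exact hne (eq_of_contract_eq hp (fun v hv => hc ⟨v, hv⟩) hpi hqi hpq)
  obtain ⟨v, hv⟩ := this
  unfold ancCount
  refine Finset.card_lt_card (Finset.ssubset_iff_of_subset ?_ |>.2 ⟨(v, i), ?_, ?_⟩)
  · intro vw
    simp only [Finset.mem_filter, Finset.mem_univ, true_and]
    exact fun h => h.of_contract_eq hp hpi hqi hpq
  · exact Finset.mem_filter.2 ⟨Finset.mem_univ _, Relation.ReflTransGen.single hv⟩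
  · simp only [Finset.mem_filter, Finset.mem_univ, true_and]
    intro hc
    rcases Relation.ReflTransGen.cases_tail hc with e | ⟨u, -, e⟩
    · obtain ⟨h, hh⟩ := hq
      subst e
      exact lt_irrefl _ (hh _ _ hv)
    · exact hp u e

/-- A forest with an edge has a leaf that is not a root. -/
theorem IsForest.exists_leaf {p : Fin n → Option (Fin n)} (hp : IsForest p)
    (hne : p ≠ fun _ => none) : ∃ i j, p i = some j ∧ i ≠ j ∧ ∀ v, p v ≠ some i := by
  obtain ⟨h, hh⟩ := hp
  have : (Finset.univ.filter fun v => p v ≠ none).Nonempty := by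
    by_contra hc
    refine hne (funext fun v => ?_)
    by_contra hv
    exact hc ⟨v, by simpa using hv⟩
  obtain ⟨i, hi, hmax⟩ := Finset.exists_max_image _ h this
  obtain ⟨j, hj⟩ := Option.ne_none_iff_exists'.1 (Finset.mem_filter.1 hi).2
  refine ⟨i, j, hj, ?_, fun v hv => ?_⟩
  · rintro rfl; exact lt_irrefl _ (hh _ _ hj)
  · exact absurd (hmax v (by simp [hv])) (not_le.2 (hh _ _ hv))

namespace IsUniversalDoubleSystem

/-- The monomials of rooted forests are linearly independent. In a relation, take a forest `F` with
an edge, with nonzero coefficient, and with as many ancestor pairs as possible, and a leaf `i` of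
`F` with parent `j`. The residue along `i → j` gives a relation between forests with fewer edges,
which is trivial by induction. The coefficient of the contraction of `F` in it is, up to nonzero
factors, a sum over the forests `G` that contain `i → j` and have the same contraction; those
other than `F` have more ancestor pairs, so `F` alone contributes. -/
theorem linearIndependent_mono (hg : IsUniversalDoubleSystem s g) (hs : s * s = 1) :
    LinearIndependent ℚ fun p : {p : Fin n → Option (Fin n) // IsForest p} => mono g p.1 := by
  classical
  rw [Fintype.linearIndependent_iff]
  suffices H : ∀ (N : ℕ) (c : {p : Fin n → Option (Fin n) // IsForest p} → ℚ),
      (∀ p, c p ≠ 0 → edgeCount p.1 < N) → ∑ p, c p • mono g p.1 = 0 → ∀ p, c p = 0 from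
    fun c hc => H (n + 1) c (fun p _ => Nat.lt_succ_of_le <|
      (Finset.card_le_univ _).trans_eq (Fintype.card_fin n)) hc
  intro N
  induction N with
  | zero => exact fun c hN _ p => by_contra fun hp => absurd (hN p hp) (Nat.not_lt_zero _)
  | succ N ih =>
    intro c hN hc
    have main : ∀ p, p.1 ≠ (fun _ => none) → c p = 0 := by
      by_contra! hex
      obtain ⟨p₀, hp₀⟩ := hex
      obtain ⟨p, hp, hmax⟩ := Finset.exists_max_image
        (Finset.univ.filter fun p : {p : Fin n → Option (Fin n) // IsForest p} =>
          p.1 ≠ (fun _ => none) ∧ c p ≠ 0) (fun p => ancCount p.1) ⟨p₀, by simpa using hp₀⟩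
      simp only [Finset.mem_filter, Finset.mem_univ, true_and] at hp hmax
      obtain ⟨i, j, hij, hne, hleaf⟩ := p.2.exists_leaf hp.1
      obtain ⟨b, hb0, hb1⟩ := hg.exists_residue hs hne
      choose! t ht0 ht using hb1
      let κ : {p : Fin n → Option (Fin n) // IsForest p} →
          {p : Fin n → Option (Fin n) // IsForest p} := fun q =>
        if hq : q.1 i = some j then ⟨contract i j q.1, by
          obtain ⟨h, hh⟩ := q.2; exact ⟨h, hh.contract hq⟩⟩ else q
      have hκ : ∀ q, q.1 i = some j → (κ q).1 = contract i j q.1 := fun q hq => by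
        simp only [κ, dif_pos hq]
      -- the coefficients of the residue
      let c' : {p : Fin n → Option (Fin n) // IsForest p} → ℚ := fun r =>
        ∑ q, if q.1 i = some j ∧ κ q = r then c q * t q.1 else 0
      have hc' : ∑ r, c' r • mono g r.1 = 0 := by
        have h1 := congrArg b hc
        rw [map_sum, map_zero] at h1
        rw [← h1]
        simp only [c', Finset.sum_smul]
        rw [Finset.sum_comm]
        refine Finset.sum_congr rfl fun q _ => ?_
        rw [map_smul]
        by_cases hq : q.1 i = some j
        · rw [Finset.sum_eq_single (κ q), if_pos ⟨hq, rfl⟩, ht _ hq, hκ q hq, smul_smul]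
          · intro r _ hr
            rw [if_neg fun h => hr h.2.symm, zero_smul]
          · exact fun h => absurd (Finset.mem_univ _) h
        · rw [hb0 _ hq, smul_zero]
          exact Finset.sum_eq_zero fun r _ => by rw [if_neg fun h => hq h.1, zero_smul]
      have hN' : ∀ r, c' r ≠ 0 → edgeCount r.1 < N := by
        intro r hr
        obtain ⟨q, -, hq⟩ := Finset.exists_ne_zero_of_sum_ne_zero hr
        obtain ⟨⟨hqi, rfl⟩, hq0⟩ := ite_ne_right_iff.1 hq
        have h1 := hN q (left_ne_zero_of_mul hq0)
        have h2 := edgeCount_contract_lt hqi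
        rw [hκ q hqi]
        omega
      have h0 := ih c' hN' hc' (κ p)
      simp only [c'] at h0
      rw [Finset.sum_eq_single p, if_pos ⟨hij, rfl⟩] at h0
      · exact hp.2 ((mul_eq_zero.1 h0).resolve_right (ht0 _ hij))
      · intro q _ hqp
        rw [ite_eq_right_iff]
        rintro ⟨hqi, hqκ⟩
        have hpq : contract i j p.1 = contract i j q.1 := by rw [← hκ p hij, ← hκ q hqi, hqκ]
        have hlt := ancCount_lt hleaf hij hqi hpq (fun h => hqp (Subtype.ext h.symm)) q.2
        by_contra hcq
        refine absurd (hmax q ⟨fun h => ?_, left_ne_zero_of_mul hcq⟩) (not_le.2 hlt)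
        rw [h] at hqi
        simp at hqi
      · exact fun h => absurd (Finset.mem_univ _) h
    intro p
    by_cases hp : p.1 = fun _ => none
    · rw [Finset.sum_eq_single p (fun q _ hq => ?_) fun h => absurd (Finset.mem_univ _) h, hp,
        mono_none] at hc
      · exact (smul_eq_zero.1 hc).resolve_right hg.one_ne_zero
      · rw [main q fun h => hq (Subtype.ext (h.trans hp.symm)), zero_smul]
    · exact main p hp

/-- The monomials of rooted forests form a basis. -/
theorem rank_eq (hg : IsUniversalDoubleSystem s g) (hs : s * s = 1) :
    Module.rank ℚ R = Nat.card {p : Fin n → Option (Fin n) // IsForest p} := by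
  classical
  have hspan : ⊤ ≤ Submodule.span ℚ
      (Set.range fun p : {p : Fin n → Option (Fin n) // IsForest p} => mono g p.1) := by
    rw [← hg.toIsDoubleSystem.span_mono_eq_top hs hg.gen]
    refine Submodule.span_mono ?_
    rintro _ ⟨p, hp, rfl⟩
    exact ⟨⟨p, hp⟩, rfl⟩
  rw [rank_eq_card_basis (Module.Basis.mk (hg.linearIndependent_mono hs) hspan),
    Nat.card_eq_fintype_card]

end IsUniversalDoubleSystem

end Independence

/-! ### Counting rooted forests -/

section Counting

/-- A map `p : V → V ⊕ W` without directed cycles: a forest on `V ⊕ W` whose set of roots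
is `W`. -/
def IsAcyclic {V W : Type} (p : V → V ⊕ W) : Prop :=
  ∃ h : V → ℕ, ∀ v u, p v = Sum.inl u → h u < h v

/-- Forests on `V ⊕ W` with set of roots `W`. -/
def RootedMap (V W : Type) : Type := {p : V → V ⊕ W // IsAcyclic p}

open scoped Classical in
/-- A forest with set of roots `W` in which `K` is the set of children of roots: the vertices of `K`
choose their parents freely in `W`, and the other vertices form a forest with set of roots `K`. -/
noncomputable def rootedMapFiberEquiv {V W : Type} (K : Set V) :
    {p : RootedMap V W // {v | (p.1 v).isRight} = K} ≃ (K → W) × RootedMap (Kᶜ : Set V) K where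
  toFun p :=
    ⟨fun v => (p.1.1 v).getRight ((Set.ext_iff.1 p.2 v).2 v.2),
      fun v => by
        have hv : (p.1.1 v).isLeft := by
          simpa using mt (Set.ext_iff.1 p.2 v).1 v.2
        exact if hu : (p.1.1 v).getLeft hv ∈ K then Sum.inr ⟨_, hu⟩ else Sum.inl ⟨_, hu⟩, by
      obtain ⟨h, hh⟩ := p.1.2
      refine ⟨fun v => h v, fun v u e => hh v u ?_⟩
      dsimp only at e
      split_ifs at e with hu
      rw [Sum.inl.injEq] at e
      rw [← e]
      simp⟩
  invFun q :=
    ⟨⟨fun v => if hv : v ∈ K then Sum.inr (q.1 ⟨v, hv⟩) else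
        Sum.inl ((q.2.1 ⟨v, hv⟩).elim Subtype.val Subtype.val), by
      obtain ⟨h, hh⟩ := q.2.2
      refine ⟨fun v => if hv : v ∈ K then 0 else h ⟨v, hv⟩ + 1, fun v u e => ?_⟩
      dsimp only at e ⊢
      split_ifs at e with hv
      rw [Sum.inl.injEq] at e
      rw [dif_neg hv]
      split_ifs with hu
      · omega
      · cases hw : q.2.1 ⟨v, hv⟩ with
        | inl w =>
          rw [hw, Sum.elim_inl] at e
          have := hh _ _ hw
          subst e
          simpa using this
        | inr w =>
          rw [hw, Sum.elim_inr] at e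
          subst e
          exact absurd w.2 hu⟩, by
      ext v
      by_cases hv : v ∈ K <;> simp [hv]⟩
  left_inv p := by
    obtain ⟨⟨p, hp⟩, rfl⟩ := p
    refine Subtype.ext (Subtype.ext (funext fun v => ?_))
    by_cases hv : (p v).isRight
    · simp [hv]
    · obtain ⟨u, hu⟩ : ∃ u, p v = Sum.inl u := by
        cases h : p v with
        | inl u => exact ⟨u, rfl⟩
        | inr u => simp [h] at hv
      by_cases h' : (p u).isRight <;> simp [hu, h']
  right_inv q := by
    obtain ⟨f, ⟨q, hq⟩⟩ := q
    refine Prod.ext (funext fun v => ?_) (Subtype.ext (funext fun v => ?_))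
    · simp
    · have hv : v.1 ∉ K := v.2
      cases h : q v with
      | inl u =>
        have hu : u.1 ∉ K := u.2
        simp [hv, h, hu]
      | inr u => simp [hv, h]

/-- Without roots there is no forest on a nonempty set. -/
theorem isEmpty_rootedMap {V W : Type} [Nonempty V] [IsEmpty W] : IsEmpty (RootedMap V W) := by
  refine ⟨fun ⟨p, h, hh⟩ => ?_⟩
  obtain ⟨v, hv⟩ : ∃ v, ∀ u, h v ≤ h u :=
    ⟨Function.argmin h, fun u => Function.argmin_le h u⟩
  cases e : p v with
  | inl u => exact absurd (hv u) (not_le.2 (hh v u e))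
  | inr w => exact isEmptyElim w

/-- The recursion for the numbers `r (r + N) ^ (N - 1)` given by the number `k` of children of
roots. -/
theorem sum_choose_mul_pow (r M : ℕ) :
    ∑ k ∈ Finset.range (M + 2), (M + 1).choose k *
      (if k = 0 then 0 else r ^ k *
        if M + 1 - k = 0 then 1 else k * (k + (M + 1 - k)) ^ (M + 1 - k - 1)) =
      r * (r + (M + 1)) ^ M := by
  rw [Finset.sum_range_succ', add_pow r (M + 1) M, Finset.mul_sum]
  simp only [if_true, mul_zero, add_zero, Nat.succ_ne_zero, if_false]
  refine Finset.sum_congr rfl fun k hk => ?_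
  have hkM : k ≤ M := Nat.lt_succ_iff.1 (Finset.mem_range.1 hk)
  obtain ⟨d, rfl⟩ := Nat.exists_eq_add_of_le hkM
  have h1 : k + d + 1 - (k + 1) = d := by omega
  have h2 : k + d - k = d := by omega
  rw [h1, h2]
  cases d with
  | zero => simp [pow_succ, mul_comm]
  | succ d =>
    have h3 : k + 1 + (d + 1) = k + (d + 1) + 1 := by ring
    have h4 := Nat.add_one_mul_choose_eq (k + (d + 1)) k
    rw [if_neg (Nat.succ_ne_zero d), h3, Nat.add_sub_cancel, pow_succ r k,
      pow_succ (k + (d + 1) + 1) d]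
    calc _ = r ^ k * r * (k + (d + 1) + 1) ^ d * ((k + (d + 1) + 1).choose (k + 1) * (k + 1)) := by
          ring
      _ = _ := by rw [← h4, Nat.cast_id]; ring

/-- The number of forests on `r + N` vertices with `r` prescribed roots. -/
theorem card_rootedMap (N : ℕ) : ∀ (V W : Type) [Finite V] [Finite W], Nat.card V = N →
    Nat.card (RootedMap V W) =
      if N = 0 then 1 else Nat.card W * (Nat.card W + N) ^ (N - 1) := by
  induction N using Nat.strong_induction_on with
  | _ N ih =>
    intro V W _ _ hV
    classical
    have := Fintype.ofFinite V
    have : Finite (RootedMap V W) := Subtype.finite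
    rcases N with _ | M
    · have : IsEmpty V := (Nat.card_eq_zero.1 hV).resolve_right fun h => h.not_finite ‹_›
      rw [if_pos rfl, Nat.card_eq_one_iff_unique]
      exact ⟨⟨fun p q => Subtype.ext (funext fun v => isEmptyElim v)⟩,
        ⟨⟨fun v => isEmptyElim v, fun _ => 0, fun v => isEmptyElim v⟩⟩⟩
    have : Nonempty V := (Nat.card_pos_iff.1 (by omega)).1
    have fiber : ∀ K : Finset V,
        Nat.card {p : RootedMap V W // {v | (p.1 v).isRight} = (K : Set V)} =
          if K.card = 0 then 0 else Nat.card W ^ K.card *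
            if M + 1 - K.card = 0 then 1
              else K.card * (K.card + (M + 1 - K.card)) ^ (M + 1 - K.card - 1) := by
      intro K
      have hc : Nat.card ((K : Set V)ᶜ : Set V) = M + 1 - K.card := by
        rw [← hV, Nat.card_coe_set_eq, Set.ncard_compl, Set.ncard_coe_finset]
      have hK : Nat.card (K : Set V) = K.card := by
        rw [Nat.card_coe_set_eq, Set.ncard_coe_finset]
      rw [Nat.card_congr (rootedMapFiberEquiv (K : Set V)), Nat.card_prod, Nat.card_fun, hK]
      split_ifs with h0 h1
      · obtain rfl := Finset.card_eq_zero.1 h0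
        have : Nonempty (((∅ : Finset V) : Set V)ᶜ : Set V) := by simp
        have : IsEmpty ((∅ : Finset V) : Set V) := by simp
        have := isEmpty_rootedMap (V := (((∅ : Finset V) : Set V)ᶜ : Set V))
          (W := ((∅ : Finset V) : Set V))
        rw [Nat.card_of_isEmpty (α := RootedMap _ _), mul_zero]
      · rw [ih _ (by omega) _ _ hc, if_pos h1]
      · rw [ih _ (by omega) _ _ hc, if_neg h1, hK]
    rw [if_neg (Nat.succ_ne_zero M), Nat.add_sub_cancel,
      ← Nat.card_congr (Equiv.sigmaFiberEquiv fun p : RootedMap V W => {v | (p.1 v).isRight}),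
      Nat.card_sigma, ← Fintype.finsetEquivSet.sum_comp]
    simp only [Fintype.finsetEquivSet_apply, fiber]
    rw [← Finset.powerset_univ, Finset.sum_powerset_apply_card (fun k =>
      if k = 0 then 0 else Nat.card W ^ k *
        if M + 1 - k = 0 then 1 else k * (k + (M + 1 - k)) ^ (M + 1 - k - 1)),
      Finset.card_univ, ← Nat.card_eq_fintype_card, hV]
    simp only [smul_eq_mul]
    rw [sum_choose_mul_pow]

/-- The number of rooted forests on `n` vertices. The case `n = 0` has one forest, in accordance
with the truncated exponent. -/
theorem card_isForest (n : ℕ) :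
    Nat.card {p : Fin n → Option (Fin n) // IsForest p} = (n + 1) ^ (n - 1) := by
  have e : {p : Fin n → Option (Fin n) // IsForest p} ≃ RootedMap (Fin n) PUnit :=
    (Equiv.arrowCongr (Equiv.refl _) (Equiv.optionEquivSumPUnit (Fin n))).subtypeEquiv fun p => by
      refine exists_congr fun h => forall_congr' fun v => forall_congr' fun u => ?_
      cases hp : p v <;> simp [hp]
  rw [Nat.card_congr e, card_rootedMap n _ _ (Nat.card_eq_fintype_card.trans (Fintype.card_fin n))]
  rcases n with _ | n
  · simp
  · simp [add_comm]

end Counting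

/-! ### The two algebras -/

section Algebras

/-- The generator with colour `c` on `{v, w}`. -/
def colouredGen {n : ℕ} (c : Bool) (v w : Fin n) (h : v ≠ w) : DoubleOSGen n :=
  bif c then DoubleOSGen.y v w h else DoubleOSGen.x v w h

/-- The system of generators of an algebra given by the images of the generators, extended by zero
to pairs of equal vertices. -/
def extendGen {n : ℕ} {B : Type} [Ring B] (φ : DoubleOSGen n → B) (c : Bool) (v w : Fin n) : B :=
  if h : v ≠ w then φ (colouredGen c v w h) else 0

variable {n : ℕ} {B : Type}

section

variable [Ring B]

theorem extendGen_of_ne (φ : DoubleOSGen n → B) (c : Bool) {v w : Fin n} (h : v ≠ w) :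
    extendGen φ c v w = φ (colouredGen c v w h) := dif_pos h

theorem extendGen_self (φ : DoubleOSGen n → B) (c : Bool) (v : Fin n) : extendGen φ c v v = 0 :=
  dif_neg (not_not.2 rfl)

theorem extendGen_x (φ : DoubleOSGen n → B) {v w : Fin n} (h : v ≠ w) :
    extendGen φ false v w = φ (.x v w h) := dif_pos h

theorem extendGen_y (φ : DoubleOSGen n → B) {v w : Fin n} (h : v ≠ w) :
    extendGen φ true v w = φ (.y v w h) := dif_pos h

end

/-- The values of a system, as a function on the generators of the two algebras. -/
def systemVal (g : Bool → Fin n → Fin n → B) : DoubleOSGen n → B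
  | .x i j _ => g false i j
  | .y i j _ => g true i j

theorem systemVal_colouredGen (g : Bool → Fin n → Fin n → B) (c : Bool) {v w : Fin n}
    (h : v ≠ w) : systemVal g (colouredGen c v w h) = g c v w := by
  cases c <;> rfl

variable [Ring B] [Algebra ℚ B]

/-- The relations between the images of the generators, with the sign `s`, make a system. -/
theorem isDoubleSystem_extendGen {s : ℚ} (φ : DoubleOSGen n → B)
    (comm : ∀ a b, φ a * φ b = s • (φ b * φ a))
    (x_swap : ∀ i j h, φ (.x j i (Ne.symm h)) = -(s • φ (.x i j h)))
    (y_swap : ∀ i j h, φ (.y j i (Ne.symm h)) = -(s • φ (.y i j h)))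
    (xx : ∀ i j k hij hjk hki, φ (.x i j hij) * φ (.x j k hjk) + φ (.x j k hjk) * φ (.x k i hki)
      + φ (.x k i hki) * φ (.x i j hij) = 0)
    (xy : ∀ i j k hij hjk hki, φ (.x i j hij) * φ (.y j k hjk) + φ (.x j k hjk) * φ (.y k i hki)
      + φ (.x k i hki) * φ (.y i j hij) + φ (.y i j hij) * φ (.x j k hjk)
      + φ (.y j k hjk) * φ (.x k i hki) + φ (.y k i hki) * φ (.x i j hij) = 0)
    (yy : ∀ i j k hij hjk hki, φ (.y i j hij) * φ (.y j k hjk) + φ (.y j k hjk) * φ (.y k i hki)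
      + φ (.y k i hki) * φ (.y i j hij) = 0)
    (x_sq : ∀ i j h, φ (.x i j h) * φ (.x i j h) = 0)
    (x_mul_y : ∀ i j h, φ (.x i j h) * φ (.y i j h) = 0)
    (y_sq : ∀ i j h, φ (.y i j h) * φ (.y i j h) = 0) :
    IsDoubleSystem s (extendGen φ) := by
  refine IsDoubleSystem.of_distinct (extendGen_self φ) (fun c v w => ?_)
    (fun c d v w v' w' => ?_) (fun c d v w u h1 h2 h3 => ?_) (fun c d v w => ?_)
  · by_cases h : v = w
    · subst h; simp [extendGen_self]
    cases c
    · rw [extendGen_x φ h, extendGen_x φ (Ne.symm h), x_swap]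
    · rw [extendGen_y φ h, extendGen_y φ (Ne.symm h), y_swap]
  · by_cases h : v = w
    · subst h; simp [extendGen_self]
    by_cases h' : v' = w'
    · subst h'; simp [extendGen_self]
    rw [extendGen_of_ne φ _ h, extendGen_of_ne φ _ h', comm]
  · cases c <;> cases d <;>
      simp only [extendGen_x φ h1, extendGen_x φ h2, extendGen_x φ h3, extendGen_y φ h1,
        extendGen_y φ h2, extendGen_y φ h3]
    · have h := xx v w u h1 h2 h3
      rw [add_assoc, add_assoc, ← add_assoc (_ * _) (_ * _) (_ * _), h, add_zero]
    · exact xy v w u h1 h2 h3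
    · rw [← xy v w u h1 h2 h3]; abel
    · have h := yy v w u h1 h2 h3
      rw [add_assoc, add_assoc, ← add_assoc (_ * _) (_ * _) (_ * _), h, add_zero]
  · by_cases h : v = w
    · subst h; simp [extendGen_self]
    cases c <;> cases d <;> simp only [extendGen_x φ h, extendGen_y φ h]
    · exact x_sq v w h
    · exact x_mul_y v w h
    · rw [comm, x_mul_y, smul_zero]
    · exact y_sq v w h

theorem IsDoubleSystem.systemVal_mul {s : ℚ} {g : Bool → Fin n → Fin n → B}
    (hg : IsDoubleSystem s g) (a b : DoubleOSGen n) :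
    systemVal g a * systemVal g b = s • (systemVal g b * systemVal g a) := by
  cases a <;> cases b <;> exact hg.comm ..

theorem IsDoubleSystem.tri_same {s : ℚ} {g : Bool → Fin n → Fin n → B}
    (hg : IsDoubleSystem s g) (c : Bool) (v w u : Fin n) :
    g c v w * g c w u + g c w u * g c u v + g c u v * g c v w = 0 := by
  have h := hg.tri c c v w u
  rw [add_assoc, add_assoc, ← add_assoc (g c v w * _) (_ * _) (_ * _), ← two_smul ℚ] at h
  exact (smul_eq_zero.1 h).resolve_left two_ne_zero

/-- An algebra homomorphism that sends the generators to the values of a system sends the extended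
generators to the values of the system. -/
theorem IsDoubleSystem.map_extendGen {R : Type} [Ring R] [Algebra ℚ R] {s : ℚ}
    {g : Bool → Fin n → Fin n → B} (hg : IsDoubleSystem s g) {φ : DoubleOSGen n → R}
    (f : R →ₐ[ℚ] B) (hf : ∀ a, f (φ a) = systemVal g a) (c : Bool) (v w : Fin n) :
    f (extendGen φ c v w) = g c v w := by
  by_cases h : v = w
  · subst h; rw [extendGen_self, map_zero, hg.self]
  · rw [extendGen_of_ne φ c h, hf, systemVal_colouredGen]

theorem mem_of_extendGen_mem {φ : DoubleOSGen n → B} {S : Subalgebra ℚ B}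
    (h : ∀ c v w, extendGen φ c v w ∈ S) (a : DoubleOSGen n) : φ a ∈ S := by
  cases a with
  | x i j hij => exact extendGen_x φ hij ▸ h false i j
  | y i j hij => exact extendGen_y φ hij ▸ h true i j

/-- The images of the generators in the double Orlik–Solomon algebra. -/
noncomputable def oddGen (a : DoubleOSGen n) : DoubleOS n :=
  RingQuot.mkAlgHom ℚ (DoubleOS.Rel n) (FreeAlgebra.ι ℚ a)

theorem isUniversalDoubleSystem_odd :
    IsUniversalDoubleSystem (-1) (extendGen (oddGen (n := n))) where
  toIsDoubleSystem := by
    have rel : ∀ {a b}, DoubleOS.Rel n a b →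
        RingQuot.mkAlgHom ℚ (DoubleOS.Rel n) a = RingQuot.mkAlgHom ℚ (DoubleOS.Rel n) b :=
      fun h => RingQuot.mkAlgHom_rel ℚ h
    have neg : ∀ a : DoubleOS n, -((-1 : ℚ) • a) = a := fun a =>
      (congrArg Neg.neg (neg_one_smul ℚ a)).trans (neg_neg a)
    refine isDoubleSystem_extendGen oddGen ?_ ?_ ?_ ?_ ?_ ?_ ?_ ?_ ?_
    · intro a b
      have := rel (.supercomm a b)
      rw [map_mul, map_neg, map_mul] at this
      exact this.trans (neg_one_smul ℚ _).symm
    · intro i j h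
      have := rel (.x_symm i j h)
      rw [map_sub, map_zero, sub_eq_zero] at this
      exact this.symm.trans (neg _).symm
    · intro i j h
      have := rel (.y_symm i j h)
      rw [map_sub, map_zero, sub_eq_zero] at this
      exact this.symm.trans (neg _).symm
    · intro i j k h1 h2 h3
      simpa [oddGen, DoubleOS.x] using rel (.xx i j k h1 h2 h3)
    · intro i j k h1 h2 h3
      simpa [oddGen, DoubleOS.x, DoubleOS.y] using rel (.xy i j k h1 h2 h3)
    · intro i j k h1 h2 h3
      simpa [oddGen, DoubleOS.y] using rel (.yy i j k h1 h2 h3)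
    · intro i j h
      simpa [oddGen, DoubleOS.x, pow_two] using rel (.x_sq i j h)
    · intro i j h
      simpa [oddGen, DoubleOS.x, DoubleOS.y] using rel (.x_mul_y i j h)
    · intro i j h
      simpa [oddGen, DoubleOS.y, pow_two] using rel (.y_sq i j h)
  gen S hS := by
    rw [Algebra.eq_top_iff]
    intro r
    obtain ⟨r, rfl⟩ := RingQuot.mkAlgHom_surjective ℚ (DoubleOS.Rel n) r
    induction r using FreeAlgebra.induction with
    | grade0 t => rw [AlgHom.commutes]; exact S.algebraMap_mem t
    | grade1 a => exact mem_of_extendGen_mem hS a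
    | mul a b ha hb => rw [map_mul]; exact S.mul_mem ha hb
    | add a b ha hb => rw [map_add]; exact S.add_mem ha hb
  lift B _ _ g hg := by
    have hsq : ∀ c d v w, g c v w * g d v w = 0 := hg.sq
    refine ⟨RingQuot.liftAlgHom ℚ ⟨FreeAlgebra.lift ℚ (systemVal g), fun a b h => ?_⟩,
      hg.map_extendGen _ fun a => ?_⟩
    · cases h with
      | supercomm a b => simpa using hg.systemVal_mul a b
      | x_symm i j h => simp [DoubleOS.x, systemVal, hg.swap false i j]
      | y_symm i j h => simp [DoubleOS.y, systemVal, hg.swap true i j]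
      | xx i j k => simpa [DoubleOS.x, systemVal] using hg.tri_same false i j k
      | xy i j k => simpa [DoubleOS.x, DoubleOS.y, systemVal] using hg.tri false true i j k
      | yy i j k => simpa [DoubleOS.y, systemVal] using hg.tri_same true i j k
      | x_sq i j h => simp [DoubleOS.x, systemVal, pow_two, hsq]
      | x_mul_y i j h => simp [DoubleOS.x, DoubleOS.y, systemVal, hsq]
      | y_sq i j h => simp [DoubleOS.y, systemVal, pow_two, hsq]
    · simp [oddGen]

/-- The images of the generators in the double even Orlik–Solomon algebra. -/
noncomputable def evenGen (a : DoubleOSGen n) : DoubleEvenOS n :=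
  Ideal.Quotient.mkₐ ℚ _ (MvPolynomial.X a)

open scoped IsMulCommutative in
theorem isUniversalDoubleSystem_even :
    IsUniversalDoubleSystem 1 (extendGen (evenGen (n := n))) where
  toIsDoubleSystem := by
    have rel : ∀ {p}, DoubleEvenOS.Relator n p →
        Ideal.Quotient.mkₐ ℚ (Ideal.span {p | DoubleEvenOS.Relator n p}) p = 0 :=
      fun h => Ideal.Quotient.eq_zero_iff_mem.2 (Ideal.subset_span h)
    refine isDoubleSystem_extendGen evenGen ?_ ?_ ?_ ?_ ?_ ?_ ?_ ?_ ?_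
    · intro a b
      rw [one_smul, mul_comm]
    · intro i j h
      have := rel (.x_skew i j h)
      rw [map_add, add_comm] at this
      rw [one_smul]
      exact eq_neg_of_add_eq_zero_left this
    · intro i j h
      have := rel (.y_skew i j h)
      rw [map_add, add_comm] at this
      rw [one_smul]
      exact eq_neg_of_add_eq_zero_left this
    · intro i j k h1 h2 h3
      have := rel (.xx i j k h1 h2 h3)
      simp only [map_add, map_mul] at this
      exact this
    · intro i j k h1 h2 h3
      have := rel (.xy i j k h1 h2 h3)
      simp only [map_add, map_mul] at this
      exact this
    · intro i j k h1 h2 h3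
      have := rel (.yy i j k h1 h2 h3)
      simp only [map_add, map_mul] at this
      exact this
    · intro i j h
      have := rel (.x_sq i j h)
      simp only [map_mul, pow_two] at this
      exact this
    · intro i j h
      have := rel (.x_mul_y i j h)
      simp only [map_mul] at this
      exact this
    · intro i j h
      have := rel (.y_sq i j h)
      simp only [map_mul, pow_two] at this
      exact this
  gen S hS := by
    rw [Algebra.eq_top_iff]
    intro r
    obtain ⟨r, rfl⟩ := Ideal.Quotient.mkₐ_surjective ℚ _ r
    induction r using MvPolynomial.induction_on with
    | C t => exact S.algebraMap_mem t
    | add a b ha hb => rw [map_add]; exact S.add_mem ha hb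
    | mul_X a i ha => rw [map_mul]; exact S.mul_mem ha (mem_of_extendGen_mem hS i)
  lift B _ _ g hg := by
    have hsq : ∀ c d v w, g c v w * g d v w = 0 := hg.sq
    -- the values of the system commute, so they generate a commutative subalgebra
    have hcomm : ∀ a ∈ Set.range (systemVal g), ∀ b ∈ Set.range (systemVal g), a * b = b * a := by
      rintro _ ⟨a, rfl⟩ _ ⟨b, rfl⟩
      simpa using hg.systemVal_mul a b
    have := Algebra.isMulCommutative_adjoin ℚ hcomm
    let ψ : MvPolynomial (DoubleOSGen n) ℚ →ₐ[ℚ] Algebra.adjoin ℚ (Set.range (systemVal g)) :=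
      MvPolynomial.aeval fun a => ⟨systemVal g a, Algebra.subset_adjoin ⟨a, rfl⟩⟩
    let Ψ : MvPolynomial (DoubleOSGen n) ℚ →ₐ[ℚ] B :=
      (Algebra.adjoin ℚ (Set.range (systemVal g))).val.comp ψ
    have hΨ : ∀ a, Ψ (MvPolynomial.X a) = systemVal g a := fun a => by
      simp [Ψ, ψ]
    have hle : ∀ p ∈ Ideal.span {p | DoubleEvenOS.Relator n p}, Ψ p = 0 := by
      intro p hp
      refine (Ideal.span_le (I := RingHom.ker Ψ)).2 (fun p hp => ?_) hp
      change Ψ p = 0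
      cases hp with
      | x_skew i j h => simp [DoubleEvenOS.x, hΨ, systemVal, hg.swap false i j]
      | y_skew i j h => simp [DoubleEvenOS.y, hΨ, systemVal, hg.swap true i j]
      | xx i j k => simpa [DoubleEvenOS.x, hΨ, systemVal] using hg.tri_same false i j k
      | xy i j k =>
        simpa [DoubleEvenOS.x, DoubleEvenOS.y, hΨ, systemVal] using hg.tri false true i j k
      | yy i j k => simpa [DoubleEvenOS.y, hΨ, systemVal] using hg.tri_same true i j k
      | x_sq i j h => simp [DoubleEvenOS.x, hΨ, systemVal, pow_two, hsq]
      | x_mul_y i j h => simp [DoubleEvenOS.x, DoubleEvenOS.y, hΨ, systemVal, hsq]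
      | y_sq i j h => simp [DoubleEvenOS.y, hΨ, systemVal, pow_two, hsq]
    exact ⟨Ideal.Quotient.liftₐ _ Ψ hle, hg.map_extendGen _ hΨ⟩

end Algebras

theorem theorem2 (n : ℕ) :
    Module.rank ℚ (DoubleOS n) = (((n + 1) ^ (n - 1) : ℕ) : Cardinal) ∧
      Module.rank ℚ (DoubleEvenOS n) = (((n + 1) ^ (n - 1) : ℕ) : Cardinal) := by
  rw [← card_isForest n]
  exact ⟨isUniversalDoubleSystem_odd.rank_eq (by norm_num),
    isUniversalDoubleSystem_even.rank_eq (by norm_num)⟩
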